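/- Let $\mathfrak h$ be a separable, infinite-dimensional complex Hilbert space and let $n\ge 1$. Let ${}^{\rm w}\mathscr G_n(\mathfrak h)$ denote the set of orthogonal projections of $\mathfrak h$ of rank $n$, with the subspace topology induced by the weak operator topology on the bounded operators of $\mathfrak h$. By a classifying space $B\mathbb U(n)$ of the unitary group $\mathbb U(n)$ we mean the base space of a (locally trivial) principal $\mathbb U(n)$-bundle whose total space is weakly contractible (non-empty, with all homotopy groups trivial, including $\pi_0$). Such spaces exist, and for every classifying space $B\mathbb U(n)$ and every choice of base points in ${}^{\rm w}\mathscr G_n(\mathfrak h)$ and $B\mathbb U(n)$ (the groups of $\mathbb U(n)$ being taken at the identity) one has $$\pi_k\big({}^{\rm w}\mathscr G_n(\mathfrak h)\big)\;\cong\;\pi_k\big(B\mathbb U(n)\big)\quad(k\ge 0),\qquad \pi_k\big({}^{\rm w}\mathscr G_n(\mathfrak h)\big)\;\cong\;\begin{cases}0 & \text{if } k=0,\\ \pi_{k-1}(\mathbb U(n)) & \text{if } k\ge 1,\end{cases}$$ where for $k\ge 1$ the isomorphisms are isomorphisms of groups (for $k=1$ the set $\pi_0(\mathbb U(n))$ carries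 the group structure induced by that of $\mathbb U(n)$), and for $k=0$ they are bijections of sets. In particular ${}^{\rm w}\mathscr G_n(\mathfrak h)$ is path-connected. -/

import Mathlib

open scoped Topology

universe u v w

/-- The Grassmannian of rank `n` of a complex Hilbert space `h`: the orthogonal projections
`P = P* = P²` of `h` with rank `n`, as a subspace of the bounded operators on `h` with the
weak operator topology. (`LinearMap.rank` is cardinal-valued, so the range of such a `P` is
finite-dimensional also for `n = 0`.) -/
abbrev WeakGrassmannian (n : ℕ) (h : Type*) [NormedAddCommGroup h] [InnerProductSpace ℂ h]
    [CompleteSpace h] : Type _ :=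
  {P : h →WOT[ℂ] h // IsStarProjection P.toCLM ∧ (P.toCLM : h →ₗ[ℂ] h).rank = n}

/-- A space is weakly contractible if all its homotopy groups vanish; for `k = 0` this says
(together with non-emptiness) that it is path-connected. -/
def IsWeaklyContractible (E : Type*) [TopologicalSpace E] : Prop :=
  Nonempty E ∧ ∀ (k : ℕ) (x : E), Subsingleton (π_ k E x)

/-- `p : E → B` is a principal `G`-bundle for the given continuous action of `G` on `E`: the
action preserves the fibres and there are equivariant local trivializations
`p ⁻¹' U ≃ U × G` around every point of `B`, where `G` acts on `U × G` by translation of the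
second factor. (Hence `p` is surjective, the action is free, the fibres of `p` are the orbits
and `B` carries the quotient topology.) -/
structure IsPrincipalBundle (G : Type*) [Group G] [TopologicalSpace G] {E B : Type*}
    [TopologicalSpace E] [TopologicalSpace B] [MulAction G E] (p : E → B) : Prop where
  continuous_smul : Continuous fun q : G × E => q.1 • q.2
  map_smul : ∀ (g : G) (x : E), p (g • x) = p x
  locally_trivial : ∀ b : B, ∃ e : Bundle.Trivialization G p, b ∈ e.baseSet ∧
    ∀ (g : G) (x : E), x ∈ e.source → (e (g • x)).2 = g * (e x).2

/-- `B` is a classifying space `BG` of the topological group `G`: the base of a principal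
`G`-bundle with weakly contractible total space `EG`. -/
def IsClassifyingSpace (G : Type u) [Group G] [TopologicalSpace G]
    (B : Type v) [TopologicalSpace B] : Prop :=
  ∃ (E : Type w) (_ : TopologicalSpace E) (_ : MulAction G E) (p : E → B),
    IsWeaklyContractible E ∧ IsPrincipalBundle G p

/-- The class of the point `y` in `π_0(X)`. (The base point `x` is irrelevant.) -/
noncomputable def pi0Class {X : Type*} [TopologicalSpace X] (x y : X) : π_ 0 X x :=
  (HomotopyGroup.pi0EquivZerothHomotopy (X := X) (x := x)).symm (Quotient.mk _ y)

/-!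
The Grassmannian is itself a classifying space of the unitary group. The orthonormal `n`-frames of
`h` form the Stiefel manifold, on which `U(n)` acts, and a frame is sent to the projection onto its
span. On projections the weak operator topology agrees with the strong one
(`WeakGrassmannian.continuous_apply`), so that Gram-Schmidt orthonormalization gives local sections
and the frames form a principal bundle (`isPrincipalBundle_frameProjection`). The Stiefel manifold
is contractible, because frames can be moved into the range of a shift operator and from there to a
fixed frame that is orthogonal to this range (`contractibleSpace_stiefelManifold`).

For every principal `G`-bundle `E → B` with weakly contractible total space, the boundary map
`π_{k+1}(B) → π_k(G)` is an isomorphism (`IsPrincipalBundle.nonempty_pi_mulEquiv`, and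
`IsPrincipalBundle.exists_pi_one_equiv` for `k = 0`). It is set up as a relation `IsBoundaryOf`
between representatives; as it is multiplicative, it is enough to look at its values and its
preimages at the identity. The homotopy lifting property that this needs has a simple form for
principal bundles: any map from a cube to `B` has some lift (`IsPrincipalBundle.exists_lift_Icc`),
and a lift prescribed on a retract of the cube differs from it by a `G`-valued function, which
extends along the retraction (`IsPrincipalBundle.exists_lift_extension`).
-/

section

open scoped unitInterval Topology.Homotopy

/-! ### Principal bundles: translation function and lifts of maps from cubes -/

namespace IsPrincipalBundle

variable {G : Type*} [Group G] [TopologicalSpace G] {E B : Type*} [TopologicalSpace E]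
  [TopologicalSpace B] [MulAction G E] {p : E → B}

theorem continuous (hp : IsPrincipalBundle G p) : Continuous p :=
  continuous_iff_continuousAt.2 fun x ↦ by
    obtain ⟨e, hb, -⟩ := hp.locally_trivial (p x)
    exact e.continuousAt_proj (e.mem_source.2 hb)

theorem surjective (hp : IsPrincipalBundle G p) : Function.Surjective p := fun b ↦ by
  obtain ⟨e, hb, -⟩ := hp.locally_trivial b
  exact ⟨e.toOpenPartialHomeomorph.symm (b, 1), e.proj_symm_apply' hb⟩

theorem exists_smul_eq (hp : IsPrincipalBundle G p) {x y : E} (h : p x = p y) :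
    ∃ g : G, g • x = y := by
  obtain ⟨e, hb, he⟩ := hp.locally_trivial (p x)
  have hx : x ∈ e.source := e.mem_source.2 hb
  have hy : y ∈ e.source := e.mem_source.2 (h ▸ hb)
  have hgx : ((e y).2 * (e x).2⁻¹) • x ∈ e.source := e.mem_source.2 (by rwa [hp.map_smul])
  refine ⟨(e y).2 * (e x).2⁻¹, e.injOn hgx hy (Prod.ext ?_ ?_)⟩
  · change (e _).1 = (e _).1
    rw [e.coe_fst hgx, e.coe_fst hy, hp.map_smul, h]
  · change (e _).2 = (e _).2
    rw [he _ _ hx, inv_mul_cancel_right]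

theorem smul_left_injective (hp : IsPrincipalBundle G p) (x : E) :
    Function.Injective fun g : G ↦ g • x := fun g g' h ↦ by
  obtain ⟨e, hb, he⟩ := hp.locally_trivial (p x)
  have hx : x ∈ e.source := e.mem_source.2 hb
  have := congrArg (fun y ↦ (e y).2) h
  simpa [he _ _ hx] using this

/-- The translation function of a principal bundle: for two points `x`, `y` of the same fibre,
the unique `g` with `g • x = y`. -/
noncomputable def translation (hp : IsPrincipalBundle G p) (z : {z : E × E // p z.1 = p z.2}) : G :=
  (hp.exists_smul_eq z.2).choose

theorem translation_smul (hp : IsPrincipalBundle G p) (z : {z : E × E // p z.1 = p z.2}) :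
    hp.translation z • z.1.1 = z.1.2 :=
  (hp.exists_smul_eq z.2).choose_spec

theorem continuous_translation [IsTopologicalGroup G] (hp : IsPrincipalBundle G p) :
    Continuous hp.translation := by
  refine continuous_iff_continuousAt.2 fun z₀ ↦ ?_
  obtain ⟨e, hb, he⟩ := hp.locally_trivial (p z₀.1.1)
  have h₁ : z₀.1.1 ∈ e.source := e.mem_source.2 hb
  have h₂ : z₀.1.2 ∈ e.source := e.mem_source.2 (z₀.2 ▸ hb)
  have c₁ : ContinuousAt (fun z : {z : E × E // p z.1 = p z.2} ↦ z.1.1) z₀ := by fun_prop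
  have c₂ : ContinuousAt (fun z : {z : E × E // p z.1 = p z.2} ↦ z.1.2) z₀ := by fun_prop
  have e₁ : ContinuousAt (fun z : {z : E × E // p z.1 = p z.2} ↦ (e z.1.1).2) z₀ :=
    continuousAt_snd.comp (ContinuousAt.comp (f := fun z : {z : E × E // p z.1 = p z.2} ↦ z.1.1)
      (e.continuousAt h₁) c₁)
  have e₂ : ContinuousAt (fun z : {z : E × E // p z.1 = p z.2} ↦ (e z.1.2).2) z₀ :=
    continuousAt_snd.comp (ContinuousAt.comp (f := fun z : {z : E × E // p z.1 = p z.2} ↦ z.1.2)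
      (e.continuousAt h₂) c₂)
  refine (e₂.mul e₁.inv).congr ?_
  filter_upwards [c₁.preimage_mem_nhds (e.open_source.mem_nhds h₁)] with z hz
  have := he (hp.translation z) _ hz
  rw [hp.translation_smul] at this
  change (e z.1.2).2 * (e z.1.1).2⁻¹ = _
  rw [this, mul_inv_cancel_right]

/-- Given a global lift `L`, every partial lift over a retract extends to a global lift: it differs
from `L` by a `G`-valued function on the retract, which extends along the retraction. -/
theorem exists_lift_extension [IsTopologicalGroup G] (hp : IsPrincipalBundle G p)
    {Y : Type*} [TopologicalSpace Y] (L s : C(Y, E)) (r : C(Y, Y)) {A : Set Y}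
    (hrA : ∀ y, r y ∈ A) (hr : ∀ y ∈ A, r y = y) (hs : ∀ y ∈ A, p (L y) = p (s y)) :
    ∃ F : C(Y, E), (∀ y, p (F y) = p (L y)) ∧ ∀ y ∈ A, F y = s y := by
  refine ⟨⟨fun y ↦ hp.translation ⟨(L (r y), s (r y)), hs _ (hrA y)⟩ • L y,
    hp.continuous_smul.comp (.prodMk (hp.continuous_translation.comp (by fun_prop)) (by fun_prop))⟩,
    fun y ↦ hp.map_smul _ _, fun y hy ↦ ?_⟩
  have := hp.translation_smul ⟨(L (r y), s (r y)), hs _ (hrA y)⟩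
  simp only [hr y hy] at this
  simpa [hr y hy] using this

section Boxes

variable {N : Type*}

/-- Lifts over the two halves of a box that is cut by a hyperplane give a lift over the box. -/
theorem exists_lift_Icc_of_split [DecidableEq N] [IsTopologicalGroup G]
    (hp : IsPrincipalBundle G p) (f : (N → ℝ) → B) {a b : N → ℝ} (hab : a ≤ b) (i : N) {c : ℝ}
    (hac : a i ≤ c) (hcb : c ≤ b i)
    (h₁ : ∃ s : C(N → ℝ, E), ∀ x ∈ Set.Icc a (Function.update b i c), p (s x) = f x)
    (h₂ : ∃ s : C(N → ℝ, E), ∀ x ∈ Set.Icc (Function.update a i c) b, p (s x) = f x) :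
    ∃ s : C(N → ℝ, E), ∀ x ∈ Set.Icc a b, p (s x) = f x := by
  obtain ⟨s₁, hs₁⟩ := h₁
  obtain ⟨s₂, hs₂⟩ := h₂
  -- `k` retracts onto the box, `u` onto the common face of the two halves
  let k : (N → ℝ) → N → ℝ := fun x ↦ (a ⊔ x) ⊓ b
  have hk : Continuous k := by
    refine continuous_pi fun j ↦ ?_
    change Continuous fun x : N → ℝ ↦ (a j ⊔ x j) ⊓ b j
    fun_prop
  have hkab : ∀ x, k x ∈ Set.Icc a b := fun x ↦ ⟨le_inf le_sup_left hab, inf_le_right⟩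
  let u : (N → ℝ) → N → ℝ := fun x ↦ Function.update (k x) i c
  have hu : Continuous u := hk.update i continuous_const
  have hu₁ : ∀ x, u x ∈ Set.Icc a (Function.update b i c) := fun x ↦
    ⟨le_update_iff.2 ⟨hac, fun j _ ↦ (hkab x).1 j⟩,
      update_le_update_iff.2 ⟨le_rfl, fun j _ ↦ (hkab x).2 j⟩⟩
  have hu₂ : ∀ x, u x ∈ Set.Icc (Function.update a i c) b := fun x ↦
    ⟨update_le_update_iff.2 ⟨le_rfl, fun j _ ↦ (hkab x).1 j⟩,
      update_le_iff.2 ⟨hcb, fun j _ ↦ (hkab x).2 j⟩⟩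
  have hus : ∀ x, p (s₂ (u x)) = p (s₁ (u x)) := fun x ↦
    (hs₂ _ (hu₂ x)).trans (hs₁ _ (hu₁ x)).symm
  let γ : (N → ℝ) → G := fun x ↦ hp.translation ⟨(s₂ (u x), s₁ (u x)), hus x⟩
  have hγ : Continuous γ := hp.continuous_translation.comp (by fun_prop)
  have hs : Continuous fun x ↦ if k x i ≤ c then s₁ (k x) else γ x • s₂ (k x) := by
    refine Continuous.if_le (by fun_prop)
      (hp.continuous_smul.comp (hγ.prodMk (s₂.continuous.comp hk))) (by fun_prop)
      continuous_const fun x hx ↦ ?_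
    have hux : u x = k x := by simp [u, ← hx]
    have := hp.translation_smul ⟨(s₂ (u x), s₁ (u x)), hus x⟩
    simp only [hux] at this
    simpa [γ, hux] using this.symm
  refine ⟨⟨_, hs⟩, fun x hx ↦ ?_⟩
  have hkx : k x = x := by
    simp only [k, sup_eq_right.2 hx.1, inf_eq_left.2 hx.2]
  simp only [ContinuousMap.coe_mk, hkx]
  split_ifs with hc
  · exact hs₁ _ ⟨hx.1, le_update_iff.2 ⟨hc, fun j _ ↦ hx.2 j⟩⟩
  · rw [hp.map_smul]
    exact hs₂ _ ⟨update_le_iff.2 ⟨(not_le.1 hc).le, fun j _ ↦ hx.1 j⟩, hx.2⟩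

/-- Maps from a cube to the base lift: this holds on small boxes by local triviality, and on larger
ones by putting boxes together, in one direction after the other. -/
theorem exists_lift_Icc [Fintype N] [IsTopologicalGroup G]
    (hp : IsPrincipalBundle G p) (f : C(N → ℝ, B)) :
    ∃ s : C(N → ℝ, E), ∀ x ∈ Set.Icc (0 : N → ℝ) 1, p (s x) = f x := by
  classical
  choose e he _ using hp.locally_trivial
  obtain ⟨δ, hδ, hball⟩ := lebesgue_number_lemma_of_metric (s := Set.Icc (0 : N → ℝ) 1)
    (c := fun b ↦ f ⁻¹' (e b).baseSet) isCompact_Icc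
    (fun b ↦ (e b).open_baseSet.preimage f.continuous)
    (fun x _ ↦ Set.mem_iUnion.2 ⟨f x, he (f x)⟩)
  -- boxes whose sides outside of `S` are short
  suffices H : ∀ S : Finset N, ∀ a b : N → ℝ, 0 ≤ a → a ≤ b → b ≤ 1 →
      (∀ i ∉ S, b i - a i < δ) →
      ∃ s : C(N → ℝ, E), ∀ x ∈ Set.Icc a b, p (s x) = f x from
    H Finset.univ 0 1 le_rfl zero_le_one le_rfl (by simp)
  intro S
  induction S using Finset.induction_on with
  | empty =>
    intro a b h0 hab h1 hS
    obtain ⟨β, hβ⟩ := hball a ⟨h0, hab.trans h1⟩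
    have hbox : ∀ x ∈ Set.Icc a b, f x ∈ (e β).baseSet := fun x hx ↦ hβ <| by
      rw [Metric.mem_ball, dist_pi_lt_iff hδ]
      intro i
      rw [Real.dist_eq, abs_of_nonneg (sub_nonneg.2 (hx.1 i))]
      linarith [hx.2 i, hS i (by simp)]
    let k : (N → ℝ) → N → ℝ := fun x ↦ (a ⊔ x) ⊓ b
    have hk : Continuous k := by
      refine continuous_pi fun j ↦ ?_
      change Continuous fun x : N → ℝ ↦ (a j ⊔ x j) ⊓ b j
      fun_prop
    have hkab : ∀ x, k x ∈ Set.Icc a b := fun x ↦ ⟨le_inf le_sup_left hab, inf_le_right⟩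
    refine ⟨⟨fun x ↦ (e β).toOpenPartialHomeomorph.symm (f (k x), 1), ?_⟩, fun x hx ↦ ?_⟩
    · refine (e β).toOpenPartialHomeomorph.continuousOn_symm.comp_continuous
        (f := fun x ↦ (f (k x), (1 : G))) (by fun_prop) fun x ↦ ?_
      rw [(e β).target_eq]
      exact ⟨hbox _ (hkab x), trivial⟩
    · have hkx : k x = x := by
        simp only [k, sup_eq_right.2 hx.1, inf_eq_left.2 hx.2]
      simp only [ContinuousMap.coe_mk, hkx]
      exact (e β).proj_symm_apply' (hbox _ hx)
  | insert i S _ ih =>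
    intro a b h0 hab h1 hS
    -- cut pieces of length `δ / 2` off the `i`-th side
    obtain ⟨m, hm⟩ := exists_nat_gt ((b i - a i) / (δ / 2))
    rw [div_lt_iff₀ (by positivity)] at hm
    induction m generalizing a with
    | zero => exact absurd (hab i) (not_le.2 (by simpa using hm))
    | succ m ihm =>
      by_cases hlt : b i - a i < δ
      · refine ih a b h0 hab h1 fun j hj ↦ ?_
        by_cases hji : j = i
        · exact hji ▸ hlt
        · exact hS j (by simp [hji, hj])
      · have hac : a i ≤ a i + δ / 2 := by linarith
        have hcb : a i + δ / 2 ≤ b i := by linarith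
        refine hp.exists_lift_Icc_of_split f hab i hac hcb ?_ ?_
        · refine ih _ _ h0 (le_update_iff.2 ⟨hac, fun j _ ↦ hab j⟩)
            ((update_le_iff.2 ⟨hcb, fun j _ ↦ le_rfl⟩).trans h1) fun j hj ↦ ?_
          by_cases hji : j = i
          · subst hji; simp; linarith
          · simpa [hji] using hS j (by simp [hji, hj])
        · have haa : a ≤ Function.update a i (a i + δ / 2) :=
            le_update_iff.2 ⟨hac, fun j _ ↦ le_rfl⟩
          refine ihm _ (h0.trans haa) (update_le_iff.2 ⟨hcb, fun j _ ↦ hab j⟩) (fun j hj ↦ ?_) ?_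
          · have := hS j hj
            have := haa j
            linarith
          · push_cast at hm
            simp only [Function.update_self]
            linarith

theorem exists_lift_cube [Fintype N] [IsTopologicalGroup G] (hp : IsPrincipalBundle G p)
    (f : C(I × (N → I), B)) : ∃ L : C(I × (N → I), E), ∀ z, p (L z) = f z := by
  let k : C(Option N → ℝ, I × (N → I)) :=
    ⟨fun x ↦ (Set.projIcc 0 1 zero_le_one (x none),
      fun i ↦ Set.projIcc 0 1 zero_le_one (x (some i))), by fun_prop⟩
  let j : C(I × (N → I), Option N → ℝ) :=
    ⟨fun z o ↦ o.elim (z.1 : ℝ) fun i ↦ (z.2 i : ℝ), continuous_pi fun o ↦ by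
      cases o <;> simp only [Option.elim] <;> fun_prop⟩
  obtain ⟨s, hs⟩ := hp.exists_lift_Icc (f.comp k)
  refine ⟨s.comp j, fun z ↦ (hs (j z) ⟨fun o ↦ ?_, fun o ↦ ?_⟩).trans ?_⟩
  · cases o
    exacts [z.1.2.1, (z.2 _).2.1]
  · cases o
    exacts [z.1.2.2, (z.2 _).2.2]
  · change f (k (j z)) = f z
    congr 1
    simp [k, j, Set.projIcc_val]

end Boxes

end IsPrincipalBundle

/-! ### The relative homotopy lifting property -/

/-- The cylinder `I × I^N` retracts onto the union of its top and its sides. -/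
theorem exists_retraction_cylinder (N : Type*) [Fintype N] :
    ∃ r : C(I × (N → I), I × (N → I)),
      (∀ z, (r z).1 = 1 ∨ (r z).2 ∈ Cube.boundary N) ∧
      ∀ z, z.1 = 1 ∨ z.2 ∈ Cube.boundary N → r z = z := by
  -- radial projection from a point below the cylinder, in the coordinates `v ∈ [-1, 1]^N`
  let v : I × (N → I) → N → ℝ := fun z i ↦ 2 * (z.2 i : ℝ) - 1
  have hv : Continuous v := by fun_prop
  have hv1 : ∀ z, ‖v z‖ ≤ 1 := fun z ↦ (pi_norm_le_iff_of_nonneg zero_le_one).2 fun i ↦ by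
    rw [Real.norm_eq_abs, abs_le]
    have := (z.2 i).2
    constructor <;> simp only [v] <;> linarith [this.1, this.2]
  let l : I × (N → I) → ℝ := fun z ↦ max ‖v z‖ ((1 + z.1) / 2)
  have hl : Continuous l := by fun_prop
  have hl0 : ∀ z, 0 < l z := fun z ↦ lt_max_of_lt_right (by linarith [z.1.2.1])
  have hl1 : ∀ z, z.1 = 1 ∨ z.2 ∈ Cube.boundary N → l z = 1 := by
    rintro z (hz | ⟨i, hz⟩)
    · simp [l, hz, hv1 z]
    · have h : 1 ≤ ‖v z‖ := by
        refine le_trans ?_ (norm_le_pi_norm (v z) i)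
        rcases hz with hz | hz <;> norm_num [v, hz]
      simp only [l]
      rw [le_antisymm (hv1 z) h, max_eq_left (by linarith [z.1.2.2])]
  refine ⟨⟨fun z ↦ (Set.projIcc 0 1 zero_le_one ((1 + z.1) / l z - 1),
    fun i ↦ Set.projIcc 0 1 zero_le_one ((v z i / l z + 1) / 2)), ?_⟩, fun z ↦ ?_, fun z hz ↦ ?_⟩
  · have : ∀ z, l z ≠ 0 := fun z ↦ (hl0 z).ne'
    refine .prodMk (continuous_projIcc.comp (by fun_prop (disch := assumption)))
      (continuous_pi fun i ↦ continuous_projIcc.comp (by fun_prop (disch := assumption)))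
  · rcases le_total ‖v z‖ ((1 + z.1) / 2) with h | h
    · left
      refine Set.projIcc_of_right_le zero_le_one ?_
      have : l z = (1 + z.1) / 2 := max_eq_right h
      have h0 := hl0 z
      rw [le_sub_iff_add_le, le_div_iff₀ h0, this]
      linarith
    · right
      have hlz : l z = ‖v z‖ := max_eq_left h
      have h0 := hl0 z
      have : Nonempty N := by
        by_contra hN
        rw [not_nonempty_iff] at hN
        simp [hlz] at h0
        exact h0 (Subsingleton.elim _ _)
      obtain ⟨i, hi⟩ : ∃ i, ‖v z i‖ = ‖v z‖ := by
        obtain ⟨i, -, hi⟩ := Finset.exists_mem_eq_sup Finset.univ Finset.univ_nonempty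
          fun i ↦ ‖v z i‖₊
        exact ⟨i, by simpa [Pi.norm_def] using congrArg NNReal.toReal hi.symm⟩
      refine ⟨i, ?_⟩
      rw [Real.norm_eq_abs, ← hlz] at hi
      rcases abs_eq h0.le |>.1 hi with hi | hi
      · right
        refine Set.projIcc_of_right_le zero_le_one ?_
        rw [hi, div_self h0.ne']; norm_num
      · left
        refine Set.projIcc_of_le_left zero_le_one ?_
        rw [hi, neg_div, div_self h0.ne']; norm_num
  · simp only [ContinuousMap.coe_mk, hl1 z hz, v]
    refine Prod.ext ?_ (funext fun i ↦ ?_)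
    · simp [Set.projIcc_val]
    · simp [Set.projIcc_val]

/-- The relative homotopy lifting property of principal bundles, for the pair of a cube and its
boundary: a lift that is prescribed on the top and the sides of a cylinder `I × I^N` extends. -/
theorem IsPrincipalBundle.exists_homotopy_lift {G : Type*} [Group G] [TopologicalSpace G]
    [IsTopologicalGroup G] {E B : Type*} [TopologicalSpace E]
    [TopologicalSpace B] [MulAction G E] {p : E → B} (hp : IsPrincipalBundle G p)
    {N : Type*} [Fintype N] (H : C(I × (N → I), B)) (F : C(N → I, E))
    (h : ∀ t y, t = 1 ∨ y ∈ Cube.boundary N → H (t, y) = p (F y)) :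
    ∃ K : C(I × (N → I), E), (∀ z, p (K z) = H z) ∧
      ∀ t y, t = 1 ∨ y ∈ Cube.boundary N → K (t, y) = F y := by
  obtain ⟨L, hL⟩ := hp.exists_lift_cube H
  obtain ⟨r, hrA, hr⟩ := exists_retraction_cylinder N
  obtain ⟨K, hK, hKA⟩ := hp.exists_lift_extension L (F.comp ⟨Prod.snd, continuous_snd⟩) r
    (A := {z | z.1 = 1 ∨ z.2 ∈ Cube.boundary N}) hrA hr
    fun z hz ↦ (hL z).trans (h z.1 z.2 hz)
  exact ⟨K, fun z ↦ (hK z).trans (hL z), fun t y hty ↦ hKA (t, y) hty⟩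

/-! ### Boundaries of cubes -/

theorem mem_boundary_of_update {N : Type*} [DecidableEq N] {y : N → I} {i : N}
    (hy : y ∈ Cube.boundary N) {s : I} (h : y i = 0 ∨ y i = 1 → s = 0 ∨ s = 1) :
    Function.update y i s ∈ Cube.boundary N := by
  obtain ⟨j, hj⟩ := hy
  by_cases hji : j = i
  · subst hji
    exact ⟨j, by simpa using h hj⟩
  · exact ⟨j, by simpa [hji] using hj⟩

theorem Fin.mem_cube_boundary_iff {k : ℕ} {x : Fin (k + 1) → I} :
    x ∈ Cube.boundary (Fin (k + 1)) ↔ x 0 = 0 ∨ x 0 = 1 ∨ Fin.tail x ∈ Cube.boundary (Fin k) := by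
  constructor
  · rintro ⟨i, hi⟩
    induction i using Fin.cases with
    | zero => tauto
    | succ i => exact Or.inr (Or.inr ⟨i, hi⟩)
  · rintro (h | h | ⟨i, h⟩)
    exacts [⟨0, Or.inl h⟩, ⟨0, Or.inr h⟩, ⟨i.succ, h⟩]

theorem Fin.cons_mem_cube_boundary_iff {k : ℕ} {t : I} {y : Fin k → I} :
    (Fin.cons t y : Fin (k + 1) → I) ∈ Cube.boundary (Fin (k + 1)) ↔
      t = 0 ∨ t = 1 ∨ y ∈ Cube.boundary (Fin k) := by
  simp [Fin.mem_cube_boundary_iff]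

/-! ### Weak contractibility -/

/-- A contraction of `X` moves the base point, hence only yields free null homotopies of spheres.
The retraction of `I × I^N` onto the top and the sides, applied at the bottom, turns them into
homotopies relative to the boundary. -/
theorem GenLoop.homotopic_const_of_contractibleSpace {X : Type*} [TopologicalSpace X]
    [ContractibleSpace X] {N : Type*} [Fintype N] {x : X} (f : Ω^ N X x) :
    GenLoop.Homotopic f GenLoop.const := by
  obtain ⟨c, ⟨H⟩⟩ := id_nullhomotopic X
  obtain ⟨r, hrA, hr⟩ := exists_retraction_cylinder N
  have H0 : ∀ a, H (0, a) = a := fun a ↦ H.apply_zero a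
  have H1 : ∀ a, H (1, a) = c := fun a ↦ H.apply_one a
  have hbd : ∀ t, ∀ y ∈ Cube.boundary N, r (t, y) = (t, y) := fun t y hy ↦ hr _ (Or.inr hy)
  let f₁ : Ω^ N X x := ⟨⟨fun y ↦ f (r (0, y)).2, by fun_prop⟩, fun y hy ↦ by
    simp [hbd _ y hy, GenLoop.boundary f y hy]⟩
  let f₂ : Ω^ N X x := ⟨⟨fun y ↦ H ((r (0, y)).1, x), by fun_prop⟩, fun y hy ↦ by
    simp [hbd _ y hy, H0]⟩
  have h₁ : GenLoop.Homotopic f₁ f := ⟨{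
    toFun := fun z ↦ f (r z).2
    map_zero_left := fun y ↦ rfl
    map_one_left := fun y ↦ by simp [hr (1, y) (Or.inl rfl)]
    prop' := fun t y hy ↦ by simp [f₁, hbd _ y hy] }⟩
  have h₂ : GenLoop.Homotopic f₁ f₂ := ⟨{
    toFun := fun z ↦ H (z.1 * (r (0, z.2)).1, f (r (0, z.2)).2)
    map_zero_left := fun y ↦ by simp [f₁, H0]
    map_one_left := fun y ↦ by
      rcases hrA (0, y) with h | h
      · simp [f₂, h, H1]
      · simp [f₂, GenLoop.boundary f _ h]
    prop' := fun t y hy ↦ by simp [f₁, hbd _ y hy, H0] }⟩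
  have h₃ : GenLoop.Homotopic GenLoop.const f₂ := ⟨{
    toFun := fun z ↦ H (z.1 * (r (0, z.2)).1, x)
    map_zero_left := fun y ↦ by simp [H0]
    map_one_left := fun y ↦ by simp [f₂]
    prop' := fun t y hy ↦ by simp [hbd _ y hy, H0] }⟩
  exact h₁.symm.trans (h₂.trans h₃.symm)

theorem IsWeaklyContractible.of_contractibleSpace (X : Type*) [TopologicalSpace X]
    [ContractibleSpace X] : IsWeaklyContractible X :=
  ⟨inferInstance, fun k x ↦ ⟨by
    have : ∀ a : π_ k X x, a = Quotient.mk _ GenLoop.const := by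
      rintro ⟨f⟩
      exact Quotient.sound (GenLoop.homotopic_const_of_contractibleSpace f)
    exact fun a b ↦ (this a).trans (this b).symm⟩⟩

theorem IsWeaklyContractible.pathConnectedSpace {X : Type*} [TopologicalSpace X]
    (h : IsWeaklyContractible X) : PathConnectedSpace X := by
  obtain ⟨x⟩ := h.1
  have := h.2 0 x
  exact pathConnectedSpace_iff_zerothHomotopy.2 ⟨⟨Quotient.mk _ x⟩,
    (HomotopyGroup.pi0EquivZerothHomotopy (X := X) (x := x)).symm.subsingleton⟩

theorem IsWeaklyContractible.homotopic {X : Type*} [TopologicalSpace X]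
    (h : IsWeaklyContractible X) {k : ℕ} {x : X} (f g : Ω^ (Fin k) X x) :
    GenLoop.Homotopic f g :=
  have := h.2 k x
  Quotient.exact (this.elim (Quotient.mk _ f) (Quotient.mk _ g))

theorem subsingleton_pi_zero {X : Type*} [TopologicalSpace X] [PathConnectedSpace X] (x : X) :
    Subsingleton (π_ 0 X x) :=
  have := (pathConnectedSpace_iff_zerothHomotopy (X := X)).1 inferInstance
  have := this.2
  (HomotopyGroup.pi0EquivZerothHomotopy (X := X) (x := x)).subsingleton

/-! ### The boundary map of a principal bundle -/

/-- A correspondence between two groups that is total on both sides, multiplicative, and relates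
the identities to nothing else, is the graph of an isomorphism. -/
theorem nonempty_mulEquiv_of_rel {Γ Δ : Type*} [Group Γ] [Group Δ] (R : Γ → Δ → Prop)
    (left_total : ∀ x, ∃ y, R x y) (right_total : ∀ y, ∃ x, R x y)
    (mul : ∀ x y x' y', R x y → R x' y' → R (x * x') (y * y'))
    (eq_one_right : ∀ y, R 1 y → y = 1) (eq_one_left : ∀ x, R x 1 → x = 1) :
    Nonempty (Γ ≃* Δ) := by
  have right_unique : ∀ x y y', R x y → R x y' → y = y' := fun x y y' h h' ↦ by
    obtain ⟨z, hz⟩ := left_total x⁻¹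
    have e := eq_one_right _ (mul_inv_cancel x ▸ mul _ _ _ _ h hz)
    have e' := eq_one_right _ (mul_inv_cancel x ▸ mul _ _ _ _ h' hz)
    exact mul_right_cancel (e.trans e'.symm)
  choose φ hφ using left_total
  let Φ : Γ →* Δ := MonoidHom.mk' φ fun x x' ↦
    right_unique _ _ _ (hφ _) (mul _ _ _ _ (hφ x) (hφ x'))
  refine ⟨MulEquiv.ofBijective Φ ⟨(injective_iff_map_eq_one Φ).2 fun x hx ↦ ?_, fun y ↦ ?_⟩⟩
  · exact eq_one_left x (hx ▸ hφ x)
  · obtain ⟨x, hx⟩ := right_total y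
    exact ⟨x, right_unique _ _ _ (hφ x) hx⟩

section Boundary

variable {G : Type*} [Group G] [TopologicalSpace G] {E B : Type*} [TopologicalSpace E]
  [TopologicalSpace B] [MulAction G E] {p : E → B} {e₀ : E} {k : ℕ}

/-- The boundary map `π_{k+1}(B) → π_k(G)` of a principal `G`-bundle `p : E → B`, as a relation
between representatives: `f` is related to `g` if it has a lift to `E`, parametrized by `I × I^k`,
that is equal to `g • e₀` on the bottom and to `e₀` on the top and the sides. -/
def IsBoundaryOf (p : E → B) (e₀ : E) (f : Ω^ (Fin (k + 1)) B (p e₀)) (g : Ω^ (Fin k) G 1) :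
    Prop :=
  ∃ F : C(I × (Fin k → I), E), (∀ t y, p (F (t, y)) = f (Fin.cons t y : Fin (k + 1) → I)) ∧
    (∀ y, F (0, y) = g y • e₀) ∧ ∀ t y, t = 1 ∨ y ∈ Cube.boundary (Fin k) → F (t, y) = e₀

namespace IsPrincipalBundle

theorem exists_isBoundaryOf [IsTopologicalGroup G] (hp : IsPrincipalBundle G p)
    (f : Ω^ (Fin (k + 1)) B (p e₀)) : ∃ g : Ω^ (Fin k) G 1, IsBoundaryOf p e₀ f g := by
  obtain ⟨F, hF, hF'⟩ := hp.exists_homotopy_lift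
    (N := Fin k) ⟨fun z ↦ f (Fin.cons z.1 z.2 : Fin (k + 1) → I), by fun_prop⟩
    (ContinuousMap.const _ e₀)
    fun t y hty ↦ GenLoop.boundary f _ (Fin.cons_mem_cube_boundary_iff.2 (Or.inr hty))
  have h0 : ∀ y, p e₀ = p (F (0, y)) := fun y ↦ by
    rw [hF]
    exact (GenLoop.boundary f _ (Fin.cons_mem_cube_boundary_iff.2 (Or.inl rfl))).symm
  have hg : Continuous fun y ↦ hp.translation ⟨(e₀, F (0, y)), h0 y⟩ :=
    hp.continuous_translation.comp (by fun_prop)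
  refine ⟨⟨⟨_, hg⟩, fun y hy ↦ hp.smul_left_injective e₀ ?_⟩, F, fun t y ↦ hF _, fun y ↦ ?_, hF'⟩
  · have := hp.translation_smul ⟨(e₀, F (0, y)), h0 y⟩
    simp only [hF' 0 y (Or.inr hy)] at this
    simpa [hF' 0 y (Or.inr hy)] using this
  · exact (hp.translation_smul ⟨(e₀, F (0, y)), h0 y⟩).symm

/-- The boundary map is surjective: a null homotopy in `E` of the sphere `g • e₀` projects to a
sphere in `B` with boundary `g`. -/
theorem exists_isBoundaryOf_of_isWeaklyContractible (hp : IsPrincipalBundle G p)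
    (hE : IsWeaklyContractible E) (g : Ω^ (Fin k) G 1) :
    ∃ f : Ω^ (Fin (k + 1)) B (p e₀), IsBoundaryOf p e₀ f g := by
  have hc := hp.continuous
  let g' : Ω^ (Fin k) E e₀ := ⟨⟨fun y ↦ g y • e₀,
    hp.continuous_smul.comp (f := fun y ↦ (g y, e₀)) (by fun_prop)⟩, fun y hy ↦ by simp [GenLoop.boundary g y hy]⟩
  obtain ⟨K⟩ := hE.homotopic g' GenLoop.const
  have hK0 : ∀ y, K (0, y) = g y • e₀ := fun y ↦ K.apply_zero y
  have hK1 : ∀ y, K (1, y) = e₀ := fun y ↦ K.apply_one y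
  have hK : ∀ t, ∀ y ∈ Cube.boundary (Fin k), K (t, y) = e₀ := fun t y hy ↦
    (K.eq_fst t hy).trans (GenLoop.boundary g' y hy)
  refine ⟨⟨⟨fun x ↦ p (K (x 0, Fin.tail x)), ?_⟩, fun x hx ↦ ?_⟩, K.toContinuousMap,
    fun t y ↦ ?_, hK0, ?_⟩
  · have : Continuous fun x : Fin (k + 1) → I ↦ Fin.tail x :=
      continuous_pi fun i ↦ continuous_apply i.succ
    fun_prop
  · rcases Fin.mem_cube_boundary_iff.1 hx with h | h | h
    · simp [h, hK0, hp.map_smul]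
    · simp [h, hK1]
    · simp [hK _ _ h]
  · simp
    rfl
  · rintro t y (rfl | hy)
    exacts [hK1 y, hK t y hy]

/-- The boundary map is well defined at the identity. -/
theorem _root_.IsBoundaryOf.homotopic_const_right [IsTopologicalGroup G]
    (hp : IsPrincipalBundle G p) {f : Ω^ (Fin (k + 1)) B (p e₀)} {g : Ω^ (Fin k) G 1}
    (h : IsBoundaryOf p e₀ f g) (hf : GenLoop.Homotopic f GenLoop.const) :
    GenLoop.Homotopic g GenLoop.const := by
  obtain ⟨F, hF, hF0, hF1⟩ := h
  obtain ⟨H⟩ := hf.symm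
  have htail : Continuous fun x : Fin (k + 1) → I ↦ Fin.tail x :=
    continuous_pi fun i ↦ continuous_apply i.succ
  have hFx : ∀ x : Fin (k + 1) → I, p (F (x 0, Fin.tail x)) = f x := fun x ↦ by
    rw [hF, Fin.cons_self_tail]
  -- lift the null homotopy of `f` to one that starts at `F`; the bottom of the lift is in the
  -- fibre of `e₀`
  obtain ⟨K, hK, hK'⟩ := hp.exists_homotopy_lift H.toContinuousMap
    ⟨fun x ↦ F (x 0, Fin.tail x), by fun_prop⟩ (by
      rintro t x (rfl | hx)
      · exact (H.apply_one x).trans (hFx x).symm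
      · exact ((H.eq_snd t hx).trans (hFx x).symm))
  have hK0 : ∀ t y, p e₀ = p (K (0, (Fin.cons t y : Fin (k + 1) → I))) := fun t y ↦ by
    rw [hK]
    exact (H.apply_zero _).symm
  let κ : I × (Fin k → I) → G := fun z ↦ hp.translation ⟨(e₀, K (0, Fin.cons z.1 z.2)), hK0 _ _⟩
  have hκ : Continuous κ := hp.continuous_translation.comp (by fun_prop)
  have hκe : ∀ t y, κ (t, y) • e₀ = K (0, Fin.cons t y) := fun t y ↦
    hp.translation_smul ⟨(e₀, K (0, Fin.cons t y)), hK0 _ _⟩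
  have hKF : ∀ t y, t = 0 ∨ t = 1 ∨ y ∈ Cube.boundary (Fin k) → κ (t, y) • e₀ = F (t, y) :=
    fun t y hty ↦ by
      rw [hκe, hK' _ _ (Or.inr (Fin.cons_mem_cube_boundary_iff.2 hty))]
      simp
  refine ⟨⟨⟨⟨κ, hκ⟩, fun y ↦ ?_, fun y ↦ ?_⟩, fun t y hy ↦ ?_⟩⟩
  all_goals apply hp.smul_left_injective e₀
  · exact (hKF 0 y (by simp)).trans (hF0 y)
  · simpa using (hKF 1 y (by simp)).trans (hF1 1 y (by simp))
  · have := (hKF t y (by simp [hy])).trans (hF1 t y (by simp [hy]))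
    simpa [GenLoop.boundary g y hy] using this

/-- The boundary map has trivial kernel. -/
theorem _root_.IsBoundaryOf.homotopic_const_left [IsTopologicalGroup G]
    (hp : IsPrincipalBundle G p) (hE : IsWeaklyContractible E)
    {f : Ω^ (Fin (k + 1)) B (p e₀)} {g : Ω^ (Fin k) G 1}
    (h : IsBoundaryOf p e₀ f g) (hg : GenLoop.Homotopic g GenLoop.const) :
    GenLoop.Homotopic f GenLoop.const := by
  obtain ⟨F, hF, hF0, hF1⟩ := h
  obtain ⟨H⟩ := hg
  have hc := hp.continuous
  have htail : Continuous fun x : Fin (k + 1) → I ↦ Fin.tail x :=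
    continuous_pi fun i ↦ continuous_apply i.succ
  have hH0 : ∀ y, H (0, y) = g y := fun y ↦ H.apply_zero y
  have hH1 : ∀ y, H (1, y) = 1 := fun y ↦ H.apply_one y
  have hH : ∀ t, ∀ y ∈ Cube.boundary (Fin k), H (t, y) = 1 := fun t y hy ↦
    (H.eq_fst t hy).trans (GenLoop.boundary g y hy)
  -- the homotopy from `g` to `1` corrects `F` to a lift of `f` that is a sphere in `E`
  let F' : Ω^ (Fin (k + 1)) E e₀ :=
    ⟨⟨fun x ↦ (H (x 0, Fin.tail x))⁻¹ • F (x 0, Fin.tail x),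
      hp.continuous_smul.comp (f := fun x : Fin (k + 1) → I ↦
        ((H (x 0, Fin.tail x))⁻¹, F (x 0, Fin.tail x))) (by fun_prop)⟩, fun x hx ↦ by
      rcases Fin.mem_cube_boundary_iff.1 hx with h | h | h
      · simp [h, hH0, hF0]
      · simp [h, hH1, hF1]
      · simp [hH _ _ h, hF1 _ _ (Or.inr h)]⟩
  have hF' : ∀ x, p (F' x) = f x := fun x ↦ by
    refine Eq.trans (b := p ((H (x 0, Fin.tail x))⁻¹ • F (x 0, Fin.tail x))) rfl ?_
    rw [hp.map_smul, hF, Fin.cons_self_tail]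
  obtain ⟨K⟩ := hE.homotopic F' GenLoop.const
  refine ⟨⟨⟨⟨fun z ↦ p (K z), by fun_prop⟩, fun x ↦ ?_, fun x ↦ ?_⟩, fun t x hx ↦ ?_⟩⟩
  · exact (congrArg p (K.apply_zero x)).trans (hF' x)
  · exact congrArg p (K.apply_one x)
  · exact (congrArg p (K.eq_fst t hx)).trans (hF' x)

/-- For `k ≥ 1` the boundary map is multiplicative, as spheres can be concatenated along a coordinate
other than the one along which they are lifted. -/
theorem _root_.IsBoundaryOf.transAt {i : Fin k} {f₁ f₂ : Ω^ (Fin (k + 1)) B (p e₀)}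
    {g₁ g₂ : Ω^ (Fin k) G 1} (h₁ : IsBoundaryOf p e₀ f₁ g₁) (h₂ : IsBoundaryOf p e₀ f₂ g₂) :
    IsBoundaryOf p e₀ (GenLoop.transAt i.succ f₁ f₂) (GenLoop.transAt i g₁ g₂) := by
  obtain ⟨F₁, hF₁, hF₁0, hF₁1⟩ := h₁
  obtain ⟨F₂, hF₂, hF₂0, hF₂1⟩ := h₂
  have hc : Continuous fun z : I × (Fin k → I) ↦ if (z.2 i : ℝ) ≤ 1 / 2
      then F₁ (z.1, Function.update z.2 i <| Set.projIcc 0 1 zero_le_one (2 * z.2 i))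
      else F₂ (z.1, Function.update z.2 i <| Set.projIcc 0 1 zero_le_one (2 * z.2 i - 1)) := by
    refine Continuous.if_le ?_ ?_ (by fun_prop) continuous_const fun z hz ↦ ?_
    · exact F₁.continuous.comp (continuous_fst.prodMk
        (continuous_snd.update i (continuous_projIcc.comp (by fun_prop))))
    · exact F₂.continuous.comp (continuous_fst.prodMk
        (continuous_snd.update i (continuous_projIcc.comp (by fun_prop))))
    · rw [hF₁1 _ _ (Or.inr ⟨i, Or.inr ?_⟩), hF₂1 _ _ (Or.inr ⟨i, Or.inl ?_⟩)]
      · simp [hz]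
      · simp [hz]
  refine ⟨⟨_, hc⟩, fun t y ↦ ?_, fun y ↦ ?_, fun t y hty ↦ ?_⟩
  · simp only [ContinuousMap.coe_mk, GenLoop.transAt, GenLoop.coe_copy, Fin.cons_succ,
      ← Fin.cons_update]
    split_ifs
    exacts [hF₁ _ _, hF₂ _ _]
  · simp only [ContinuousMap.coe_mk, GenLoop.transAt, GenLoop.coe_copy]
    split_ifs
    exacts [hF₁0 _, hF₂0 _]
  · simp only [ContinuousMap.coe_mk]
    split_ifs with h
    · refine hF₁1 _ _ (hty.imp id fun hy ↦ mem_boundary_of_update hy ?_)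
      rintro (h' | h')
      · simp [h']
      · norm_num [h'] at h
    · refine hF₂1 _ _ (hty.imp id fun hy ↦ mem_boundary_of_update hy ?_)
      rintro (h' | h')
      · norm_num [h'] at h
      · right
        norm_num [h']

/-- For `k = 0` the boundary map is multiplicative: the lift of `f₂` from `g₂ • e₀` to `e₀` is
translated by `g₁` and followed by the lift of `f₁`. The product of the classes of `f₁` and `f₂` in
`π_1` is the class of `f₂` followed by `f₁`. -/
theorem _root_.IsBoundaryOf.mul (hp : IsPrincipalBundle G p) {f₁ f₂ : Ω^ (Fin 1) B (p e₀)}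
    {g₁ g₂ g : Ω^ (Fin 0) G 1} (h₁ : IsBoundaryOf p e₀ f₁ g₁) (h₂ : IsBoundaryOf p e₀ f₂ g₂)
    (hg : ∀ y, g y = g₁ y * g₂ y) :
    IsBoundaryOf p e₀ (GenLoop.transAt 0 f₂ f₁) g := by
  obtain ⟨F₁, hF₁, hF₁0, hF₁1⟩ := h₁
  obtain ⟨F₂, hF₂, hF₂0, hF₂1⟩ := h₂
  have hc : Continuous fun z : I × (Fin 0 → I) ↦ if (z.1 : ℝ) ≤ 1 / 2
      then g₁ z.2 • F₂ (Set.projIcc 0 1 zero_le_one (2 * z.1), z.2)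
      else F₁ (Set.projIcc 0 1 zero_le_one (2 * z.1 - 1), z.2) := by
    refine Continuous.if_le (hp.continuous_smul.comp (f := fun z : I × (Fin 0 → I) ↦
      (g₁ z.2, F₂ (Set.projIcc 0 1 zero_le_one (2 * z.1), z.2))) ?_) ?_ (by fun_prop)
      continuous_const fun z hz ↦ ?_
    · exact (g₁.1.continuous.comp continuous_snd).prodMk
        (F₂.continuous.comp (.prodMk (continuous_projIcc.comp (by fun_prop)) continuous_snd))
    · exact F₁.continuous.comp (.prodMk (continuous_projIcc.comp (by fun_prop)) continuous_snd)
    · rw [hz]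
      simp [hF₂1, hF₁0]
  refine ⟨⟨_, hc⟩, fun t y ↦ ?_, fun y ↦ ?_, fun t y hty ↦ ?_⟩
  · simp only [ContinuousMap.coe_mk, GenLoop.transAt, GenLoop.coe_copy, Fin.cons_zero,
      Fin.update_cons_zero]
    split_ifs
    · rw [hp.map_smul]
      exact hF₂ _ _
    · exact hF₁ _ _
  · simp [hF₂0, hg, mul_smul]
  · rcases hty with rfl | ⟨i, -⟩
    · norm_num [hF₁1]
    · exact i.elim0

/-- The boundary map `π_{k+2}(B) → π_{k+1}(G)` is an isomorphism. -/
theorem nonempty_pi_mulEquiv [IsTopologicalGroup G] (hp : IsPrincipalBundle G p)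
    (hE : IsWeaklyContractible E) (k : ℕ) (b : B) :
    Nonempty (π_ (k + 2) B b ≃* π_ (k + 1) G 1) := by
  obtain ⟨e₀, rfl⟩ := hp.surjective b
  refine nonempty_mulEquiv_of_rel
    (fun x y ↦ ∃ f g, IsBoundaryOf p e₀ f g ∧ Quotient.mk _ f = x ∧ Quotient.mk _ g = y)
    ?_ ?_ ?_ ?_ ?_
  · rintro ⟨f⟩
    obtain ⟨g, hg⟩ := hp.exists_isBoundaryOf f
    exact ⟨_, f, g, hg, rfl, rfl⟩
  · rintro ⟨g⟩
    obtain ⟨f, hf⟩ := hp.exists_isBoundaryOf_of_isWeaklyContractible (e₀ := e₀) hE g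
    exact ⟨_, f, g, hf, rfl, rfl⟩
  · rintro _ _ _ _ ⟨f, g, h, rfl, rfl⟩ ⟨f', g', h', rfl, rfl⟩
    exact ⟨_, _, h'.transAt (i := 0) h, HomotopyGroup.mul_spec.symm, HomotopyGroup.mul_spec.symm⟩
  · rintro _ ⟨f, g, h, hf, rfl⟩
    exact Quotient.sound (h.homotopic_const_right hp (Quotient.exact hf))
  · rintro _ ⟨f, g, h, rfl, hg⟩
    exact Quotient.sound (h.homotopic_const_left hp hE (Quotient.exact hg))

end IsPrincipalBundle

/-- The congruence on a topological group that identifies the points of a path component; the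
quotient by it is `π_0(G)` with its group structure. -/
def joinedCon (G : Type*) [Group G] [TopologicalSpace G] [ContinuousMul G] : Con G where
  toSetoid := pathSetoid G
  mul' := Joined.mul

theorem pi0Class_surjective {X : Type*} [TopologicalSpace X] (x : X) :
    Function.Surjective (pi0Class x) := fun a ↦ by
  obtain ⟨y, hy⟩ := Quotient.exists_rep (HomotopyGroup.pi0EquivZerothHomotopy a)
  exact ⟨y, by rw [pi0Class, hy, Equiv.symm_apply_apply]⟩

/-- The boundary map `π_1(B) → π_0(G)` is an isomorphism. -/
theorem IsPrincipalBundle.exists_pi_one_equiv [IsTopologicalGroup G] (hp : IsPrincipalBundle G p)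
    (hE : IsWeaklyContractible E) (b : B) :
    ∃ e : π_ 1 B b ≃ π_ 0 G 1, ∀ x y : G,
      e.symm (pi0Class 1 (x * y)) = e.symm (pi0Class 1 x) * e.symm (pi0Class 1 y) := by
  obtain ⟨e₀, rfl⟩ := hp.surjective b
  have key : Nonempty (π_ 1 B (p e₀) ≃* (joinedCon G).Quotient) := by
    refine nonempty_mulEquiv_of_rel
      (fun x y ↦ ∃ f g, IsBoundaryOf p e₀ f g ∧ Quotient.mk _ f = x ∧
        ((g 0 : G) : (joinedCon G).Quotient) = y) ?_ ?_ ?_ ?_ ?_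
    · rintro ⟨f⟩
      obtain ⟨g, hg⟩ := hp.exists_isBoundaryOf f
      exact ⟨_, f, g, hg, rfl, rfl⟩
    · rintro ⟨g⟩
      obtain ⟨f, hf⟩ := hp.exists_isBoundaryOf_of_isWeaklyContractible (e₀ := e₀) hE
        ((genLoopHomeoOfIsEmpty (Fin 0) 1).symm g)
      exact ⟨_, f, _, hf, rfl, rfl⟩
    · rintro _ _ _ _ ⟨f, g, h, rfl, rfl⟩ ⟨f', g', h', rfl, rfl⟩
      refine ⟨_, (genLoopHomeoOfIsEmpty (Fin 0) 1).symm (g 0 * g' 0), h.mul hp h' fun y ↦ ?_,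
        HomotopyGroup.mul_spec.symm, rfl⟩
      rw [Subsingleton.elim y 0]
      rfl
    · rintro _ ⟨f, g, h, hf, rfl⟩
      obtain ⟨H⟩ := h.homotopic_const_right hp (Quotient.exact hf)
      exact Quotient.sound ⟨{
        toFun := fun t ↦ H (t, 0)
        source' := H.apply_zero 0
        target' := H.apply_one 0 }⟩
    · rintro _ ⟨f, g, h, rfl, hg⟩
      obtain ⟨γ⟩ : Joined (g 0) 1 := Quotient.exact hg
      refine Quotient.sound (h.homotopic_const_left hp hE ⟨{
        toFun := fun z ↦ γ z.1
        map_zero_left := fun y ↦ by simp [Subsingleton.elim y 0]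
        map_one_left := fun y ↦ by simp
        prop' := fun t y ⟨i, _⟩ ↦ i.elim0 }⟩)
  obtain ⟨e⟩ := key
  refine ⟨e.toEquiv.trans (HomotopyGroup.pi0EquivZerothHomotopy (X := G) (x := 1)).symm,
    fun x y ↦ ?_⟩
  exact map_mul e.symm (x : (joinedCon G).Quotient) (y : (joinedCon G).Quotient)

end Boundary

/-! ### Principal bundles from local sections -/

section LocalSections

variable {G : Type*} [Group G] [TopologicalSpace G] {E B : Type*} [TopologicalSpace E]
  [TopologicalSpace B] [MulAction G E] {p : E → B}

/-- A free action with a continuous translation function, whose orbits are the fibres of a map with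
local sections, is a principal bundle. -/
theorem IsPrincipalBundle.of_local_sections (hp : Continuous p)
    (hsmul : Continuous fun q : G × E ↦ q.1 • q.2) (hmap : ∀ (g : G) (x : E), p (g • x) = p x)
    (hfree : ∀ x : E, Function.Injective fun g : G ↦ g • x)
    (τ : {z : E × E // p z.1 = p z.2} → G) (hτ : Continuous τ)
    (hτs : ∀ z, τ z • z.1.1 = z.1.2)
    (hs : ∀ b, ∃ U : Set B, IsOpen U ∧ b ∈ U ∧ ∃ s : B → E, ContinuousOn s U ∧
      ∀ c ∈ U, p (s c) = c) : IsPrincipalBundle G p := by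
  classical
  refine ⟨hsmul, hmap, fun b ↦ ?_⟩
  obtain ⟨U, hU, hbU, s, hsU, hps⟩ := hs b
  let φ : E → G := fun x ↦ if hx : p x ∈ U then τ ⟨(s (p x), x), hps _ hx⟩ else 1
  have hφ : ∀ x, p x ∈ U → φ x • s (p x) = x := fun x hx ↦ by
    simp only [φ, dif_pos hx]
    exact hτs ⟨(s (p x), x), hps _ hx⟩
  have hφc : ContinuousOn φ (p ⁻¹' U) := by
    rw [continuousOn_iff_continuous_domRestrict]
    have hsp : Continuous fun x : p ⁻¹' U ↦ s (p x) :=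
      hsU.comp_continuous (hp.comp continuous_subtype_val) fun x ↦ x.2
    have : (p ⁻¹' U).domRestrict φ = fun x : p ⁻¹' U ↦ τ ⟨(s (p x), x), hps _ x.2⟩ := by
      funext x
      exact dif_pos x.2
    rw [this]
    exact hτ.comp (Continuous.subtype_mk (hsp.prodMk continuous_subtype_val) _)
  refine ⟨{
    toFun := fun x ↦ (p x, φ x)
    invFun := fun z ↦ z.2 • s z.1
    source := p ⁻¹' U
    target := U ×ˢ Set.univ
    map_source' := fun x hx ↦ ⟨hx, trivial⟩
    map_target' := fun z hz ↦ by simpa [hmap, hps _ hz.1] using hz.1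
    left_inv' := fun x hx ↦ hφ x hx
    right_inv' := fun z hz ↦ ?_
    open_source := hU.preimage hp
    open_target := hU.prod isOpen_univ
    continuousOn_toFun := hp.continuousOn.prodMk hφc
    continuousOn_invFun := hsmul.comp_continuousOn
      (continuousOn_snd.prodMk (hsU.comp continuousOn_fst fun z hz ↦ hz.1))
    baseSet := U
    open_baseSet := hU
    source_eq := rfl
    target_eq := rfl
    proj_toFun := fun _ _ ↦ rfl }, hbU, fun g x hx ↦ ?_⟩
  · have hz1 : p (z.2 • s z.1) = z.1 := (hmap _ _).trans (hps _ hz.1)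
    refine Prod.ext hz1 (hfree (s z.1) ?_)
    have := hφ (z.2 • s z.1) (by rw [hz1]; exact hz.1)
    rwa [hz1] at this
  · have hx : p x ∈ U := hx
    refine hfree (s (p x)) ?_
    have := hφ (g • x) (by rwa [hmap])
    rw [hmap] at this
    change φ (g • x) • s (p x) = (g * φ x) • s (p x)
    rw [this, mul_smul, hφ x hx]

end LocalSections

/-! ### Continuity of Gram-Schmidt orthonormalization -/

section GramSchmidt

variable {h : Type*} [NormedAddCommGroup h] [InnerProductSpace ℂ h] {n : ℕ}

theorem gramSchmidtNormed_of_orthonormal {f : Fin n → h} (hf : Orthonormal ℂ f) :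
    InnerProductSpace.gramSchmidtNormed ℂ f = f := by
  funext i
  rw [InnerProductSpace.gramSchmidtNormed, InnerProductSpace.gramSchmidt_of_orthogonal ℂ hf.2,
    hf.1 i]
  simp

theorem continuous_gramSchmidtNormed {Y : Type*} [TopologicalSpace Y] {f : Y → Fin n → h}
    (hf : Continuous f) (hli : ∀ y, LinearIndependent ℂ (f y)) :
    Continuous fun y ↦ InnerProductSpace.gramSchmidtNormed ℂ (f y) := by
  have h0 : ∀ y i, (‖InnerProductSpace.gramSchmidt ℂ (f y) i‖ : ℂ) ≠ 0 := fun y i ↦ by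
    simpa using InnerProductSpace.gramSchmidt_ne_zero i (hli y)
  have key : ∀ i, Continuous fun y ↦ InnerProductSpace.gramSchmidt ℂ (f y) i := by
    intro i
    induction i using WellFoundedLT.induction with
    | _ i ih =>
    have hdef : ∀ y, InnerProductSpace.gramSchmidt ℂ (f y) i = f y i - ∑ j ∈ Finset.Iio i,
        (inner ℂ (InnerProductSpace.gramSchmidt ℂ (f y) j) (f y i) /
          (‖InnerProductSpace.gramSchmidt ℂ (f y) j‖ : ℂ) ^ 2) •
          InnerProductSpace.gramSchmidt ℂ (f y) j :=
      fun y ↦ eq_sub_of_add_eq (InnerProductSpace.gramSchmidt_def'' ℂ (f y) i).symm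
    simp_rw [hdef]
    refine .sub (by fun_prop) (continuous_finsetSum _ fun j hj ↦ ?_)
    have hj := ih j (Finset.mem_Iio.1 hj)
    refine .smul (.div (.inner hj (by fun_prop)) (by fun_prop) fun y ↦ pow_ne_zero 2 (h0 y j)) hj
  refine continuous_pi fun i ↦ ?_
  have := key i
  exact .smul (.inv₀ (by fun_prop) fun y ↦ h0 y i) this

end GramSchmidt

/-! ### Contractibility of the Stiefel manifold -/

section Stiefel

/-- The Stiefel manifold of orthonormal `n`-frames of `h`, with the norm topology. -/
abbrev StiefelManifold (n : ℕ) (h : Type*) [NormedAddCommGroup h] [InnerProductSpace ℂ h] :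
    Type _ :=
  {f : Fin n → h // Orthonormal ℂ f}

variable {n : ℕ} {h : Type*} [NormedAddCommGroup h] [InnerProductSpace ℂ h]

theorem StiefelManifold.continuous_apply (i : Fin n) :
    Continuous fun f : StiefelManifold n h ↦ f.1 i :=
  (_root_.continuous_apply i).comp continuous_subtype_val

/-- If the segments between the vectors of two families of frames stay linearly independent, then
Gram-Schmidt orthonormalization turns them into a homotopy of frames. -/
theorem homotopic_of_linearIndependent {Y : Type*} [TopologicalSpace Y]
    (f₀ f₁ : C(Y, StiefelManifold n h)) (hli : ∀ (t : I) (y : Y),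
      LinearIndependent ℂ fun i ↦ (1 - t : ℂ) • (f₀ y).1 i + (t : ℂ) • (f₁ y).1 i) :
    f₀.Homotopic f₁ := by
  have hc : Continuous fun z : I × Y ↦ fun i ↦
      (1 - z.1 : ℂ) • (f₀ z.2).1 i + (z.1 : ℂ) • (f₁ z.2).1 i := by
    refine continuous_pi fun i ↦ .add (.smul (by fun_prop) ?_) (.smul (by fun_prop) ?_)
    · exact (StiefelManifold.continuous_apply i).comp (f₀.continuous.comp continuous_snd)
    · exact (StiefelManifold.continuous_apply i).comp (f₁.continuous.comp continuous_snd)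
  refine ⟨⟨⟨fun z ↦ ⟨_, InnerProductSpace.gramSchmidtNormed_orthonormal (hli z.1 z.2)⟩,
    (continuous_gramSchmidtNormed hc fun z ↦ hli z.1 z.2).subtype_mk _⟩, fun y ↦ Subtype.ext ?_,
    fun y ↦ Subtype.ext ?_⟩⟩
  · simpa using gramSchmidtNormed_of_orthonormal (f₀ y).2
  · simpa using gramSchmidtNormed_of_orthonormal (f₁ y).2

/-- An infinite-dimensional Hilbert space has a unilateral shift `S` of multiplicity at least `n`:
it has no eigenvector, so that the segment from the identity to `S` consists of injective
operators, and its range is orthogonal to an `n`-frame. -/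
theorem exists_shift [CompleteSpace h] (hn : 1 ≤ n) (hdim : ¬ FiniteDimensional ℂ h) :
    ∃ (S : h →ₗᵢ[ℂ] h) (v : Fin n → h), Orthonormal ℂ v ∧ (∀ i x, inner ℂ (v i) (S x) = 0) ∧
      ∀ (t : I) (x : h), (1 - t : ℂ) • x + (t : ℂ) • S x = 0 → x = 0 := by
  classical
  obtain ⟨w, b, -⟩ := exists_hilbertBasis ℂ h
  have : Infinite w := by
    by_contra hw
    rw [not_infinite_iff_finite] at hw
    have := Fintype.ofFinite w
    exact hdim (b.toOrthonormalBasis.toBasis.finiteDimensional_of_finite)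
  obtain ⟨ε⟩ : Nonempty (w ≃ w × ℕ) := Cardinal.eq.1 (by simp)
  let sh : w → w := fun i ↦ ε.symm ((ε i).1, (ε i).2 + n)
  have hsh : Function.Injective sh := fun i j hij ↦ by
    have := ε.symm.injective hij
    simp only [Prod.mk.injEq, add_left_inj] at this
    exact ε.injective (Prod.ext this.1 this.2)
  have hbs : Orthonormal ℂ (b ∘ sh) := b.orthonormal.comp sh hsh
  let S : h →ₗᵢ[ℂ] h := hbs.orthogonalFamily.linearIsometry.comp b.repr.toLinearIsometry
  have hSb : ∀ i, S (b i) = b (sh i) := fun i ↦ by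
    change hbs.orthogonalFamily.linearIsometry (b.repr (b i)) = _
    rw [b.repr_self, hbs.orthogonalFamily.linearIsometry_apply_single]
    simp
  have hSsum : ∀ x, HasSum (fun i ↦ b.repr x i • b (sh i)) (S x) := fun x ↦ by
    have := hbs.orthogonalFamily.hasSum_linearIsometry (b.repr x)
    simp only [LinearIsometry.toSpanSingleton_apply, Function.comp_apply] at this
    exact this
  have hlow : ∀ (a : w) (m : ℕ), m < n → ∀ x, inner ℂ (b (ε.symm (a, m))) (S x) = 0 := by
    intro a m hm x
    refine HasSum.unique ((innerSL ℂ (b (ε.symm (a, m)))).hasSum (hSsum x)) ?_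
    have : ∀ i, ε.symm (a, m) ≠ sh i := fun i hi ↦ by
      have := congrArg Prod.snd (ε.symm.injective hi)
      simp at this
      omega
    simp [b.orthonormal.inner_eq_zero (this _)]
  have hhigh : ∀ (a : w) (m : ℕ) (x : h),
      inner ℂ (b (ε.symm (a, m + n))) (S x) = inner ℂ (b (ε.symm (a, m))) x := by
    intro a m x
    have : b (ε.symm (a, m + n)) = S (b (ε.symm (a, m))) := by simp [hSb, sh]
    rw [this, S.inner_map_map]
  obtain ⟨a₀⟩ : Nonempty w := inferInstance
  refine ⟨S, fun i ↦ b (ε.symm (a₀, i)), b.orthonormal.comp _ fun i j hij ↦ ?_,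
    fun i x ↦ hlow a₀ i i.2 x, fun t x hx ↦ ?_⟩
  · have := congrArg Prod.snd (ε.symm.injective hij)
    exact Fin.ext this
  by_cases ht : (1 - t : ℂ) = 0
  · have ht1 : (t : ℂ) = 1 := (sub_eq_zero.1 ht).symm
    rw [ht1] at hx
    have : S x = 0 := by simpa using hx
    exact S.injective (this.trans S.map_zero.symm)
  · have key : ∀ (a : w) (m : ℕ), inner ℂ (b (ε.symm (a, m))) x = 0 := by
      intro a m
      induction m using Nat.strong_induction_on with
      | _ m ih =>
      have hinner := congrArg (inner ℂ (b (ε.symm (a, m)))) hx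
      rw [inner_add_right, inner_smul_right, inner_smul_right, inner_zero_right] at hinner
      have : inner ℂ (b (ε.symm (a, m))) (S x) = 0 := by
        rcases lt_or_ge m n with hmn | hmn
        · exact hlow a m hmn x
        · obtain ⟨l, rfl⟩ := Nat.exists_eq_add_of_le' hmn
          rw [hhigh]
          exact ih l (by omega)
      rw [this, mul_zero, add_zero] at hinner
      exact (mul_eq_zero.1 hinner).resolve_left ht
    refine b.repr.injective (lp.ext (funext fun i ↦ ?_))
    rw [b.repr_apply_apply]
    simpa using key (ε i).1 (ε i).2

/-- The Stiefel manifold of an infinite-dimensional Hilbert space is contractible: move all frames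
into the range of a shift `S`, and from there to a fixed frame that is orthogonal to the range. -/
theorem contractibleSpace_stiefelManifold [CompleteSpace h] (hn : 1 ≤ n)
    (hdim : ¬ FiniteDimensional ℂ h) : ContractibleSpace (StiefelManifold n h) := by
  obtain ⟨S, v, hv, hvS, hS⟩ := exists_shift hn hdim
  let Sf : C(StiefelManifold n h, StiefelManifold n h) :=
    ⟨fun f ↦ ⟨S ∘ f.1, f.2.comp_linearIsometry S⟩, .subtype_mk (continuous_pi fun i ↦
      S.continuous.comp (StiefelManifold.continuous_apply i)) _⟩
  refine (contractible_iff_id_nullhomotopic _).2 ⟨⟨v, hv⟩,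
    (homotopic_of_linearIndependent (ContinuousMap.id _) Sf fun t f ↦ ?_).trans
    (homotopic_of_linearIndependent Sf (ContinuousMap.const _ ⟨v, hv⟩) fun t f ↦ ?_)⟩
  · have hker : LinearMap.ker ((1 - t : ℂ) • LinearMap.id + (t : ℂ) • S.toLinearMap) = ⊥ :=
      LinearMap.ker_eq_bot'.2 fun x hx ↦ hS t x hx
    exact f.2.linearIndependent.map' _ hker
  · rw [Fintype.linearIndependent_iff]
    intro c hc
    change ∑ i, c i • ((1 - t : ℂ) • S (f.1 i) + (t : ℂ) • v i) = 0 at hc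
    by_cases ht : (t : ℂ) = 0
    · have hSf : Orthonormal ℂ (S ∘ f.1) := f.2.comp_linearIsometry S
      exact Fintype.linearIndependent_iff.1 hSf.linearIndependent c (by simpa [ht] using hc)
    · intro j
      have := congrArg (inner ℂ (v j)) hc
      simp only [inner_sum, inner_smul_right, inner_add_right, hvS, mul_zero, zero_add,
        inner_zero_right, orthonormal_iff_ite.1 hv, mul_ite, mul_one, Finset.sum_ite_eq,
        Finset.mem_univ, if_true] at this
      exact (mul_eq_zero.1 this).resolve_right ht

/-! ### The frame bundle over the Grassmannian -/

theorem orthonormal_unitary_smul (g : Matrix.unitaryGroup (Fin n) ℂ) (f : StiefelManifold n h) :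
    Orthonormal ℂ fun i ↦ ∑ j, g.1 i j • f.1 j := by
  rw [orthonormal_iff_ite]
  intro i k
  rw [f.2.inner_sum]
  have := congrFun₂ (Matrix.mem_unitaryGroup_iff.1 g.2) k i
  simp only [Matrix.mul_apply, Matrix.star_apply, Matrix.one_apply] at this
  simp_rw [eq_comm (a := i), ← this]
  exact Finset.sum_congr rfl fun j _ ↦ mul_comm _ _

/-- The unitary group acts on frames through linear combinations of the vectors of the frame. -/
instance : MulAction (Matrix.unitaryGroup (Fin n) ℂ) (StiefelManifold n h) where
  smul g f := ⟨fun i ↦ ∑ j, g.1 i j • f.1 j, orthonormal_unitary_smul g f⟩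
  one_smul f := Subtype.ext (funext fun i ↦ by
    change ∑ j, (1 : Matrix (Fin n) (Fin n) ℂ) i j • f.1 j = f.1 i
    simp [Matrix.one_apply])
  mul_smul g g' f := Subtype.ext (funext fun i ↦ by
    change ∑ j, (g.1 * g'.1) i j • f.1 j = ∑ k, g.1 i k • ∑ j, g'.1 k j • f.1 j
    simp_rw [Matrix.mul_apply, Finset.sum_smul, Finset.smul_sum, mul_smul]
    exact Finset.sum_comm)

theorem StiefelManifold.smul_apply (g : Matrix.unitaryGroup (Fin n) ℂ) (f : StiefelManifold n h)
    (i : Fin n) : (g • f).1 i = ∑ j, g.1 i j • f.1 j := rfl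

instance (f : Fin n → h) : (Submodule.span ℂ (Set.range f)).HasOrthogonalProjection :=
  have := FiniteDimensional.span_of_finite ℂ (Set.finite_range f)
  inferInstance

theorem Orthonormal.starProjection_span_apply {f : Fin n → h} (hf : Orthonormal ℂ f) (x : h) :
    (Submodule.span ℂ (Set.range f)).starProjection x = ∑ i, inner ℂ (f i) x • f i := by
  refine Submodule.eq_starProjection_of_mem_orthogonal
    (Submodule.sum_mem _ fun i _ ↦ Submodule.smul_mem _ _ (Submodule.subset_span (Set.mem_range_self i)))
    ((Submodule.mem_orthogonal _ _).2 fun u hu ↦ ?_)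
  induction hu using Submodule.span_induction with
  | mem u hu =>
    obtain ⟨j, rfl⟩ := hu
    rw [inner_sub_right, hf.inner_right_fintype, sub_self]
  | zero => simp
  | add u v _ _ hu hv => rw [inner_add_left, hu, hv, add_zero]
  | smul a u _ hu => rw [inner_smul_left, hu, mul_zero]

variable [CompleteSpace h]

/-- The projection onto the span of a frame. -/
noncomputable def frameProjection (f : StiefelManifold n h) : WeakGrassmannian n h :=
  ⟨.ofCLM (Submodule.span ℂ (Set.range f.1)).starProjection,
    isStarProjection_starProjection, by
      have := FiniteDimensional.span_of_finite ℂ (Set.finite_range f.1)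
      rw [ContinuousLinearMapWOT.toCLM_ofCLM, LinearMap.rank, Submodule.range_starProjection,
        ← Module.finrank_eq_rank, finrank_span_eq_card f.2.linearIndependent, Fintype.card_fin]⟩

theorem frameProjection_apply (f : StiefelManifold n h) (x : h) :
    (frameProjection f).1 x = ∑ i, inner ℂ (f.1 i) x • f.1 i :=
  f.2.starProjection_span_apply x

theorem continuous_frameProjection :
    Continuous (frameProjection : StiefelManifold n h → WeakGrassmannian n h) := by
  refine Continuous.subtype_mk (ContinuousLinearMapWOT.continuous_of_dual_apply_continuous
    fun x y ↦ ?_) _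
  change Continuous fun f : StiefelManifold n h ↦ y ((frameProjection f).1 x)
  simp_rw [frameProjection_apply]
  refine y.continuous.comp (continuous_finsetSum _ fun i _ ↦ ?_)
  have := StiefelManifold.continuous_apply (h := h) i
  exact .smul (this.inner continuous_const) this

theorem WeakGrassmannian.finite_range (P : WeakGrassmannian n h) :
    Module.Finite ℂ P.1.toCLM.range ∧ Module.finrank ℂ P.1.toCLM.range = n :=
  ⟨Module.finite_of_rank_eq_nat P.2.2, Module.finrank_eq_of_rank_eq P.2.2⟩

/-- An `n`-frame in the range of a projection of rank `n` spans that range. -/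
theorem frameProjection_eq_iff {f : StiefelManifold n h} {P : WeakGrassmannian n h} :
    frameProjection f = P ↔ ∀ i, P.1 (f.1 i) = f.1 i := by
  constructor
  · rintro rfl i
    exact Submodule.starProjection_eq_self_iff.2 (Submodule.subset_span ⟨i, rfl⟩)
  · intro hP
    obtain ⟨_, hfr⟩ := P.finite_range
    have hle : Submodule.span ℂ (Set.range f.1) = P.1.toCLM.range := by
      refine Submodule.eq_of_le_of_finrank_eq (Submodule.span_le.2 ?_) ?_
      · rintro _ ⟨i, rfl⟩
        exact ⟨f.1 i, hP i⟩
      · rw [hfr, finrank_span_eq_card f.2.linearIndependent, Fintype.card_fin]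
    obtain ⟨_, hPr⟩ := isStarProjection_iff_eq_starProjection_range.1 P.2.1
    refine Subtype.ext (ContinuousLinearMapWOT.toCLM_injective ?_)
    rw [hPr]
    exact Submodule.starProjection_inj.2 hle

theorem exists_frameProjection_eq (P : WeakGrassmannian n h) : ∃ f, frameProjection f = P := by
  obtain ⟨_, hfr⟩ := P.finite_range
  let b := (stdOrthonormalBasis ℂ P.1.toCLM.range).reindex (finCongr hfr)
  refine ⟨⟨fun i ↦ b i, b.orthonormal.comp_linearIsometry (Submodule.subtypeₗᵢ _)⟩,
    frameProjection_eq_iff.2 fun i ↦ ?_⟩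
  obtain ⟨x, hx⟩ := (b i).2
  have := congrArg (fun A : h →L[ℂ] h ↦ A x) P.2.1.isIdempotentElem.eq
  change P.1 (b i : h) = b i
  rw [← hx]
  exact this

/-- On projections, the weak and the strong operator topology agree: `‖P x‖² = ⟪x, P x⟫`. -/
theorem WeakGrassmannian.continuous_apply (x : h) :
    Continuous fun P : WeakGrassmannian n h ↦ P.1 x := by
  refine continuous_iff_continuousAt.2 fun P₀ ↦ tendsto_iff_norm_sub_tendsto_zero.2 ?_
  have hw : ∀ y, Continuous fun P : WeakGrassmannian n h ↦ (inner ℂ y (P.1 x)).re := fun y ↦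
    Complex.continuous_re.comp
      ((ContinuousLinearMapWOT.continuous_dual_apply x (innerSL ℂ y)).comp continuous_subtype_val)
  have hP : ∀ P : WeakGrassmannian n h, inner ℂ (P.1 x) (P.1 x) = inner ℂ x (P.1 x) := fun P ↦ by
    have h1 : P.1 (P.1 x) = P.1 x :=
      congrArg (fun A : h →L[ℂ] h ↦ A x) P.2.1.isIdempotentElem.eq
    have h2 := P.2.1.isSelfAdjoint.isSymmetric x (P.1 x)
    change inner ℂ (P.1 x) (P.1 x) = inner ℂ x (P.1 (P.1 x)) at h2
    rw [h2, h1]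
  have hsq : ∀ P : WeakGrassmannian n h, ‖P.1 x - P₀.1 x‖ =
      √((inner ℂ x (P.1 x)).re - 2 * (inner ℂ (P₀.1 x) (P.1 x)).re + ‖P₀.1 x‖ ^ 2) := fun P ↦ by
    rw [← Real.sqrt_sq (norm_nonneg (P.1 x - P₀.1 x)), norm_sub_rev, @norm_sub_sq ℂ, ← hP P,
      ← inner_self_eq_norm_sq (𝕜 := ℂ) (P.1 x)]
    congr 1
    simp only [RCLike.re_to_complex]
    ring
  simp_rw [hsq]
  have hc : Continuous fun P : WeakGrassmannian n h ↦
      √((inner ℂ x (P.1 x)).re - 2 * (inner ℂ (P₀.1 x) (P.1 x)).re + ‖P₀.1 x‖ ^ 2) := by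
    have := hw x
    have := hw (P₀.1 x)
    fun_prop
  have := hc.tendsto P₀
  rwa [← hsq, sub_self, norm_zero] at this

/-- Near `P₀`, orthonormalizing the images under `P` of a frame of the range of `P₀` gives a frame
of the range of `P`. -/
theorem StiefelManifold.exists_local_section (P₀ : WeakGrassmannian n h) :
    ∃ U : Set (WeakGrassmannian n h), IsOpen U ∧ P₀ ∈ U ∧
      ∃ s : WeakGrassmannian n h → StiefelManifold n h, ContinuousOn s U ∧
        ∀ P ∈ U, frameProjection (s P) = P := by
  classical
  obtain ⟨f₀, hf₀⟩ := exists_frameProjection_eq P₀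
  let F : WeakGrassmannian n h → Fin n → h := fun P i ↦ P.1 (f₀.1 i)
  have hF : Continuous F := continuous_pi fun i ↦ WeakGrassmannian.continuous_apply _
  have hF0 : F P₀ = f₀.1 := funext fun i ↦ frameProjection_eq_iff.1 hf₀ i
  let U : Set (WeakGrassmannian n h) := {P | LinearIndependent ℂ (F P)}
  let s : WeakGrassmannian n h → StiefelManifold n h := fun P ↦ if hP : P ∈ U then
    ⟨_, InnerProductSpace.gramSchmidtNormed_orthonormal hP⟩ else f₀
  have hs : ∀ P (hP : P ∈ U), s P = ⟨_, InnerProductSpace.gramSchmidtNormed_orthonormal hP⟩ :=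
    fun P hP ↦ dif_pos hP
  refine ⟨U, isOpen_setOfPred_linearIndependent.preimage hF, ?_, s, ?_, fun P hP ↦ ?_⟩
  · change LinearIndependent ℂ (F P₀)
    rw [hF0]
    exact f₀.2.linearIndependent
  · rw [continuousOn_iff_continuous_domRestrict]
    have : U.domRestrict s = fun P : U ↦ ⟨_, InnerProductSpace.gramSchmidtNormed_orthonormal P.2⟩ :=
      funext fun P ↦ hs P P.2
    rw [this]
    exact (continuous_gramSchmidtNormed (hF.comp continuous_subtype_val) fun P ↦ P.2).subtype_mk _
  · refine frameProjection_eq_iff.2 fun i ↦ ?_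
    rw [hs P hP]
    change P.1 (InnerProductSpace.gramSchmidtNormed ℂ (F P) i) =
      InnerProductSpace.gramSchmidtNormed ℂ (F P) i
    have hmem : InnerProductSpace.gramSchmidtNormed ℂ (F P) i ∈
        Submodule.span ℂ (Set.range (F P)) := by
      rw [← InnerProductSpace.span_gramSchmidt, ← InnerProductSpace.span_gramSchmidtNormed_range]
      exact Submodule.subset_span ⟨i, rfl⟩
    generalize InnerProductSpace.gramSchmidtNormed ℂ (F P) i = y at hmem
    have hle : Submodule.span ℂ (Set.range (F P)) ≤ P.1.toCLM.range :=
      Submodule.span_le.2 (by rintro _ ⟨j, rfl⟩; exact ⟨_, rfl⟩)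
    obtain ⟨x, rfl⟩ := hle hmem
    exact congrArg (fun A : h →L[ℂ] h ↦ A x) P.2.1.isIdempotentElem.eq

theorem sum_inner_smul_of_frameProjection_eq {f f' : StiefelManifold n h}
    (hff' : frameProjection f = frameProjection f') (i : Fin n) :
    ∑ j, inner ℂ (f.1 j) (f'.1 i) • f.1 j = f'.1 i := by
  rw [← frameProjection_apply, hff']
  exact frameProjection_eq_iff.1 rfl i

/-- The bundle of orthonormal frames over the Grassmannian with the weak operator topology. -/
theorem isPrincipalBundle_frameProjection : IsPrincipalBundle (Matrix.unitaryGroup (Fin n) ℂ)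
    (frameProjection : StiefelManifold n h → WeakGrassmannian n h) := by
  refine IsPrincipalBundle.of_local_sections continuous_frameProjection ?_ ?_ ?_
    (fun z ↦ ⟨Matrix.of fun i j ↦ inner ℂ (z.1.1.1 j) (z.1.2.1 i), ?_⟩) ?_ ?_
    StiefelManifold.exists_local_section
  · refine Continuous.subtype_mk (continuous_pi fun i ↦ ?_) _
    refine continuous_finsetSum _ fun j _ ↦ Continuous.smul ?_
      ((StiefelManifold.continuous_apply j).comp continuous_snd)
    exact (continuous_subtype_val.comp continuous_fst).matrix_elem i j
  · intro g f
    refine (frameProjection_eq_iff.2 fun i ↦ ?_)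
    have := frameProjection_eq_iff.1 (rfl : frameProjection f = _)
    simp only [StiefelManifold.smul_apply, map_sum, map_smul, this]
  · intro f g g' hgg'
    refine Subtype.ext (Matrix.ext fun i j ↦ ?_)
    have := congrArg (fun f' : StiefelManifold n h ↦ inner ℂ (f.1 j) (f'.1 i)) hgg'
    simpa only [StiefelManifold.smul_apply, f.2.inner_right_fintype] using this
  · rw [Matrix.mem_unitaryGroup_iff]
    ext i k
    have := orthonormal_iff_ite.1 z.1.2.2 k i
    conv_lhs at this => rw [← sum_inner_smul_of_frameProjection_eq z.2 i, inner_sum]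
    simp only [inner_smul_right] at this
    simp only [Matrix.mul_apply, Matrix.star_apply, Matrix.of_apply, Matrix.one_apply,
      eq_comm (a := i), ← this]
    exact Finset.sum_congr rfl fun j _ ↦ congrArg _ (inner_conj_symm _ _)
  · refine Continuous.subtype_mk (continuous_matrix fun i j ↦ ?_) _
    exact ((StiefelManifold.continuous_apply j).comp
      (continuous_fst.comp continuous_subtype_val)).inner
      ((StiefelManifold.continuous_apply i).comp (continuous_snd.comp continuous_subtype_val))
  · intro z
    exact Subtype.ext (funext fun i ↦ sum_inner_smul_of_frameProjection_eq z.2 i)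

end Stiefel

end

/-! ### Homotopy groups of the Grassmannian and of classifying spaces -/

theorem corollary3p2 (n : ℕ) (hn : 1 ≤ n)
    (h : Type u) [NormedAddCommGroup h] [InnerProductSpace ℂ h] [CompleteSpace h]
    [TopologicalSpace.SeparableSpace h] (hdim : ¬ FiniteDimensional ℂ h) :
    -- path-connectedness
    PathConnectedSpace (WeakGrassmannian n h) ∧
    -- the homotopy groups in terms of those of the unitary group
    (∀ P : WeakGrassmannian n h,
      Subsingleton (π_ 0 (WeakGrassmannian n h) P) ∧
      (∃ e : π_ 1 (WeakGrassmannian n h) P ≃ π_ 0 (Matrix.unitaryGroup (Fin n) ℂ) 1,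
        ∀ a b : Matrix.unitaryGroup (Fin n) ℂ,
          e.symm (pi0Class 1 (a * b)) = e.symm (pi0Class 1 a) * e.symm (pi0Class 1 b)) ∧
      ∀ k : ℕ, Nonempty (π_ (k + 2) (WeakGrassmannian n h) P ≃*
        π_ (k + 1) (Matrix.unitaryGroup (Fin n) ℂ) 1)) ∧
    -- classifying spaces of the unitary group exist, and the homotopy groups agree with theirs
    (∃ (B : Type) (_ : TopologicalSpace B),
      IsClassifyingSpace.{0, 0, 0} (Matrix.unitaryGroup (Fin n) ℂ) B) ∧
    (∀ (B : Type v) [TopologicalSpace B],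
      IsClassifyingSpace.{0, v, w} (Matrix.unitaryGroup (Fin n) ℂ) B →
      ∀ (P : WeakGrassmannian n h) (b : B),
        Nonempty (π_ 0 (WeakGrassmannian n h) P ≃ π_ 0 B b) ∧
        ∀ k : ℕ, Nonempty (π_ (k + 1) (WeakGrassmannian n h) P ≃* π_ (k + 1) B b)) := by
  have hE := contractibleSpace_stiefelManifold (n := n) hn hdim
  have hV := IsWeaklyContractible.of_contractibleSpace (StiefelManifold n h)
  have hpG := isPrincipalBundle_frameProjection (n := n) (h := h)
  have hG : PathConnectedSpace (WeakGrassmannian n h) :=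
    hpG.surjective.pathConnectedSpace hpG.continuous
  refine ⟨hG, fun P ↦ ⟨subsingleton_pi_zero P, hpG.exists_pi_one_equiv hV P,
    fun k ↦ hpG.nonempty_pi_mulEquiv hV k P⟩, ?_, ?_⟩
  -- a classifying space in the lowest universe: the Grassmannian of `ℓ²(ℕ)`
  · have hl : ¬ FiniteDimensional ℂ (lp (fun _ : ℕ ↦ ℂ) 2) := fun hfin ↦ by
      have b : HilbertBasis ℕ ℂ (lp (fun _ : ℕ ↦ ℂ) 2) := ⟨LinearIsometryEquiv.refl _ _⟩
      exact Module.Finite.not_linearIndependent_of_infinite b b.orthonormal.linearIndependent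
    have := contractibleSpace_stiefelManifold (n := n) hn hl
    exact ⟨WeakGrassmannian n (lp (fun _ : ℕ ↦ ℂ) 2), inferInstance,
      StiefelManifold n (lp (fun _ : ℕ ↦ ℂ) 2), inferInstance, inferInstance, frameProjection,
      IsWeaklyContractible.of_contractibleSpace _, isPrincipalBundle_frameProjection⟩
  · rintro B _ ⟨E, _, _, p, hEw, hp⟩ P b
    have := hEw.pathConnectedSpace
    have : PathConnectedSpace B := hp.surjective.pathConnectedSpace hp.continuous
    have := subsingleton_pi_zero P
    have := subsingleton_pi_zero b
    refine ⟨⟨equivOfSubsingletonOfSubsingleton (fun _ ↦ default) fun _ ↦ default⟩, fun k ↦ ?_⟩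
    -- compare both sides with the homotopy groups of the unitary group
    cases k with
    | zero =>
      obtain ⟨e, he⟩ := hpG.exists_pi_one_equiv hV P
      obtain ⟨e', he'⟩ := hp.exists_pi_one_equiv hEw b
      refine ⟨⟨e.trans e'.symm, fun x y ↦ ?_⟩⟩
      obtain ⟨g, hg⟩ := pi0Class_surjective 1 (e x)
      obtain ⟨g', hg'⟩ := pi0Class_surjective 1 (e y)
      have hxy : e (x * y) = pi0Class 1 (g * g') := by
        have := he g g'
        rw [hg, hg', e.symm_apply_apply, e.symm_apply_apply] at this
        exact (e.symm_apply_eq.1 this).symm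
      have := he' g g'
      rw [hg, hg'] at this
      exact (congrArg e'.symm hxy).trans this
    | succ k =>
      obtain ⟨e⟩ := hpG.nonempty_pi_mulEquiv hV k P
      obtain ⟨e'⟩ := hp.nonempty_pi_mulEquiv hEw k b
      exact ⟨e.trans e'.symm⟩
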